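/- Consider the regular triangular lattice in the plane, with edges of length $1$. A \emph{tile} (lozenge) is the rhombus with sides of length $1$ and angles $60^\circ$ and $120^\circ$ formed by two lattice triangles that share an edge. (Up to a rigid motion, every tredoku tiling in the sense below by congruent $60^\circ$/$120^\circ$ rhombi consists of such tiles.) Two distinct tiles are \emph{adjacent} if they have a side in common and \emph{neighbours} if they have at least a vertex in common. A \emph{run} is a sequence of distinct tiles in which any two consecutive tiles share a side, all these shared sides being parallel. A \emph{tredoku tiling} is a finite set $\mathcal T$ of more than four tiles with pairwise disjoint interiors such that (P1) any two tiles of $\mathcal T$ are joined by a sequence of tiles of $\mathcal T$ in which consecutive tiles are adjacent; (P2) two tiles that touch have in common either just one vertex or just one whole side; (P3) after the removal of any one tile, any two remaining tiles are joined by a sequence of remaining tiles in which consecutive tiles are neighbours; (P4) if tiles $A$ and $B$ share a side $p$, then there is a third tile $C$ that shares with $A$ or with $B$ a side $q$ parallel to $p$; (P5) there is no run of more than three tiles. A \emph{hole} of $\mathcal T$ is a bounded connected component of the complement in the plane of the closed region covered by $\mathcal T$; tredoku tilings are allowed to have holes. \textbf{Proposition.} If $\mathcal T$ is a tredoku tiling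 with exactly $\tau$ tiles and exactly $\eta \ge 0$ holes, and each hole is an equilateral triangle of minimal size (a single lattice triangle, that is, half a tile), then \[ 2\left\lfloor \frac{\tau+1}{2}\right\rfloor \;\ge\; \left\lceil \frac12\left(\eta+\sqrt{6(2\tau+\eta)}\right)\right\rceil+\eta . \] -/

import Mathlib

namespace Tredoku

/-- A point of the regular triangular lattice of side one: `(a, b)` stands for the point
`a • (1, 0) + b • (1/2, √3/2)` of the plane. -/
abbrev Point : Type := ℤ × ℤ

/-- The three directions of lattice edges: at angles of 0, 60 and 120 degrees. -/
inductive Dir : Type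
  | d0 | d60 | d120
  deriving DecidableEq

/-- The unit vector in a given direction, in lattice coordinates. -/
def Dir.vec : Dir → Point
  | .d0 => (1, 0)
  | .d60 => (0, 1)
  | .d120 => (-1, 1)

/-- A unit edge of the triangular lattice: the segment from `start` to `start + dir.vec`.
Every edge has exactly one such representation, and two edges are parallel iff they have the
same `dir`. -/
@[ext] structure Edge : Type where
  start : Point
  dir : Dir
  deriving DecidableEq

/-- The two endpoints of an edge. -/
def Edge.endpoints (e : Edge) : Finset Point := {e.start, e.start + e.dir.vec}

/-- The unit triangles of the lattice: `up p` has vertices `p`, `p + (1, 0)`, `p + (0, 1)`, and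
`down p` has vertices `p + (1, 0)`, `p + (0, 1)`, `p + (1, 1)`. -/
inductive Triangle : Type
  | up (p : Point)
  | down (p : Point)
  deriving DecidableEq

/-- The three vertices of a unit triangle. -/
def Triangle.vertices : Triangle → Finset Point
  | .up p => {p, p + (1, 0), p + (0, 1)}
  | .down p => {p + (1, 0), p + (0, 1), p + (1, 1)}

/-- The three sides of a unit triangle. -/
def Triangle.sides : Triangle → Finset Edge
  | .up p => {⟨p, .d0⟩, ⟨p, .d60⟩, ⟨p + (1, 0), .d120⟩}
  | .down p => {⟨p + (0, 1), .d0⟩, ⟨p + (1, 0), .d60⟩, ⟨p + (1, 0), .d120⟩}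

/-- A tile (lozenge): the rhombus with unit sides and angles of 60 and 120 degrees that consists of
the two unit triangles on either side of the lattice edge `diag`, its short diagonal. The three
directions of `diag` give the three types of tile. -/
@[ext] structure Tile : Type where
  diag : Edge
  deriving DecidableEq

/-- The two unit triangles of a tile: the ones that have `diag` as a side. -/
def Tile.cells : Tile → Finset Triangle
  | ⟨⟨p, .d0⟩⟩ => {.up p, .down (p - (0, 1))}
  | ⟨⟨p, .d60⟩⟩ => {.up p, .down (p - (1, 0))}
  | ⟨⟨p, .d120⟩⟩ => {.up (p - (1, 0)), .down (p - (1, 0))}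

/-- The four vertices of a tile. -/
def Tile.vertices (t : Tile) : Finset Point := t.cells.biUnion Triangle.vertices

/-- The four sides of a tile. -/
def Tile.sides (t : Tile) : Finset Edge := (t.cells.biUnion Triangle.sides).erase t.diag

/-- Two tiles are adjacent if they are distinct and have a side in common.
The dual graph of a tiling is the subgraph induced on its tiles. -/
def adjacency : SimpleGraph Tile where
  Adj s t := s ≠ t ∧ (s.sides ∩ t.sides).Nonempty
  symm := ⟨fun s t h => ⟨h.1.symm, by rw [Finset.inter_comm]; exact h.2⟩⟩
  loopless := ⟨fun _ h => h.1 rfl⟩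

/-- Two tiles are neighbours if they are distinct and touch, that is, have a vertex in common.
The neighbour dual graph of a tiling is the subgraph induced on its tiles. -/
def neighbourhood : SimpleGraph Tile where
  Adj s t := s ≠ t ∧ (s.vertices ∩ t.vertices).Nonempty
  symm := ⟨fun s t h => ⟨h.1.symm, by rw [Finset.inter_comm]; exact h.2⟩⟩
  loopless := ⟨fun _ h => h.1 rfl⟩

/-- A run of `T` (in the direction with common edges parallel to `d`): a sequence of distinct
tiles of `T` in which any two consecutive tiles share a side parallel to `d`. -/
def IsRun (T : Finset Tile) (d : Dir) (l : List Tile) : Prop :=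
  (∀ t ∈ l, t ∈ T) ∧ l.Nodup ∧
    l.IsChain fun s t => ∃ p : Edge, p.dir = d ∧ p ∈ s.sides ∧ p ∈ t.sides

/-- A tredoku tiling (possibly with holes). -/
structure IsTredokuTiling (T : Finset Tile) : Prop where
  /-- There are more than four tiles. -/
  four_lt_card : 4 < T.card
  /-- The tiles have pairwise disjoint interiors. -/
  not_overlap : ∀ A ∈ T, ∀ B ∈ T, A ≠ B → Disjoint A.cells B.cells
  /-- P1: the tiling is connected through common sides. -/
  connected : (adjacency.induce (T : Set Tile)).Connected
  /-- P2: two tiles that touch have just one vertex or just one whole side in common. -/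
  edge_to_edge : ∀ A ∈ T, ∀ B ∈ T, neighbourhood.Adj A B →
    (A.vertices ∩ B.vertices).card = 1 ∨
      ∃ p ∈ A.sides ∩ B.sides, A.vertices ∩ B.vertices = p.endpoints
  /-- P3: the tiling stays connected when any one tile is removed, where connection through
  vertices is allowed. -/
  connected_erase : ∀ A ∈ T, (neighbourhood.induce (T.erase A : Set Tile)).Connected
  /-- P4: if `A` and `B` share a side `p`, then a third tile `C` shares a side `q` parallel to `p`
  with `A` or with `B`. -/
  third_tile : ∀ A ∈ T, ∀ B ∈ T, A ≠ B → ∀ p ∈ A.sides ∩ B.sides,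
    ∃ C ∈ T, C ≠ A ∧ C ≠ B ∧ ∃ q ∈ C.sides, q.dir = p.dir ∧ (q ∈ A.sides ∨ q ∈ B.sides)
  /-- P5: there is no run of more than three tiles. -/
  run_length_le : ∀ (d : Dir) (l : List Tile), IsRun T d l → l.length ≤ 3

/-- Two unit triangles are adjacent if they are distinct and have a side in common. -/
def triangleAdjacency : SimpleGraph Triangle where
  Adj a b := a ≠ b ∧ (a.sides ∩ b.sides).Nonempty
  symm := ⟨fun a b h => ⟨h.1.symm, by rw [Finset.inter_comm]; exact h.2⟩⟩
  loopless := ⟨fun _ h => h.1 rfl⟩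

/-- The unit triangles that are not covered by any tile of `T`. -/
def uncovered (T : Finset Tile) : Set Triangle := {c | ∀ t ∈ T, c ∉ t.cells}

/-- The holes of `T`: the bounded connected components of the complement in the plane of the closed
region covered by `T`, each given by the set of its unit triangles. A component of this open
complement consists of uncovered triangles connected through common sides, and it is bounded iff
the number of these triangles is finite. -/
def holes (T : Finset Tile) : Set (Set Triangle) :=
  {H | H.Finite ∧ ∃ C : (triangleAdjacency.induce (uncovered T)).ConnectedComponent,
    H = Subtype.val '' C.supp}

end Tredoku

namespace Tredoku

open Finset

/-! Let `s` be the number of sides shared by two tiles and `P` the number of boundary edges once the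
holes are filled. Counting tile sides gives `P + 3η + 2s ≤ 4τ`, since filling a hole removes its
three sides from the boundary (`Packing.card_boundary_add_le`, `card_boundary_union_add_le`).
Connectedness gives `τ ≤ s + 1`. By P4 and P5 the shared edges come in pairs, so `s = 2r`
(`even_card_sharedEdges`) and hence `τ - r ≤ ⌊(τ + 1) / 2⌋`. The filled region has `2τ + η`
triangles, so the isoperimetric inequality `6 * area ≤ P ^ 2` (`six_mul_card_le_card_boundary_sq`)
yields `√(6(2τ + η)) ≤ 4τ - 4r - 3η`, which rearranges to the claim.

For the isoperimetric inequality, cut the plane into unit strips in the three lattice directions. A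
strip that meets the region is crossed by at least two boundary edges, and an edge crosses strips of
two directions only, so at most `P` strips are met. A triangle is determined by its orientation and
two strip indices, whose sum fixes the third strip. The area is thus bounded by a count of pairs
with prescribed sums (`two_mul_card_sumPairs_add_le`). -/

/-! ### Counting pairs with prescribed sums -/

/-- The pairs of a grid whose sum lies in a given set. -/
def sumPairs (A B D : Finset ℤ) : Finset (ℤ × ℤ) := (A ×ˢ B).filter fun p => p.1 + p.2 ∈ D

theorem mem_sumPairs {A B D : Finset ℤ} {p : ℤ × ℤ} :
    p ∈ sumPairs A B D ↔ p.1 ∈ A ∧ p.2 ∈ B ∧ p.1 + p.2 ∈ D := by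
  simp [sumPairs, and_assoc]

theorem card_sumPairs_le (A B D : Finset ℤ) : (sumPairs A B D).card ≤ A.card * B.card := by
  rw [← card_product]
  exact card_filter_le _ _

theorem card_sumPairs_le_left (A B D : Finset ℤ) : (sumPairs A B D).card ≤ A.card * D.card := by
  rw [← card_product]
  refine card_le_card_of_injOn (fun p => (p.1, p.1 + p.2)) ?_ ?_
  · intro p hp
    have := mem_sumPairs.1 hp
    simp [this]
  · rintro ⟨a, b⟩ - ⟨c, d⟩ - h
    simp only [Prod.mk.injEq] at h ⊢
    omega

theorem card_sumPairs_le_right (A B D : Finset ℤ) : (sumPairs A B D).card ≤ B.card * D.card := by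
  rw [← card_product]
  refine card_le_card_of_injOn (fun p => (p.2, p.1 + p.2)) ?_ ?_
  · intro p hp
    have := mem_sumPairs.1 hp
    simp [this]
  · rintro ⟨a, b⟩ - ⟨c, d⟩ - h
    simp only [Prod.mk.injEq] at h ⊢
    omega

/-- The least element of `A` and the greatest of `B` together meet each sum at most once. -/
theorem card_sumPairs_le_erase_add {A B : Finset ℤ} (D : Finset ℤ) (hA : A.Nonempty)
    (hB : B.Nonempty) :
    (sumPairs A B D).card ≤
      (sumPairs (A.erase (A.min' hA)) (B.erase (B.max' hB)) D).card + D.card := by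
  rw [← card_sdiff_add_card_eq_card
    (s := sumPairs (A.erase (A.min' hA)) (B.erase (B.max' hB)) D) (t := sumPairs A B D)]
  · rw [add_comm]
    refine Nat.add_le_add_left (card_le_card_of_injOn (fun p => p.1 + p.2) ?_ ?_) _
    · intro p hp
      exact (mem_sumPairs.1 (mem_sdiff.1 hp).1).2.2
    · rintro ⟨a, b⟩ h₁ ⟨c, d⟩ h₂ h
      simp only [coe_sdiff, Set.mem_sdiff, mem_coe, mem_sumPairs, mem_erase] at h₁ h₂ h
      obtain ⟨⟨ha, hb, hab⟩, h₁⟩ := h₁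
      obtain ⟨⟨hc, hd, hcd⟩, h₂⟩ := h₂
      have := A.min'_le _ ha
      have := A.min'_le _ hc
      have := B.le_max' _ hb
      have := B.le_max' _ hd
      -- The removed pairs form a hook (least `a`, then greatest `b`) along which the sum is
      -- strictly increasing.
      have h₃ : a = A.min' hA ∨ b = B.max' hB := by tauto
      have h₄ : c = A.min' hA ∨ d = B.max' hB := by tauto
      simp only [Prod.mk.injEq]
      omega
  · intro p hp
    rw [mem_sumPairs] at hp ⊢
    exact ⟨mem_of_mem_erase hp.1, mem_of_mem_erase hp.2.1, hp.2.2⟩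

/-- Induction by removing hooks: each removal costs at most `c` pairs for `D` and for `E`, and the
right-hand side drops by exactly `4c`. The difference of the two cardinalities is preserved. -/
theorem two_mul_card_sumPairs_add_le {D E : Finset ℤ} (hDE : D ≠ E) {c : ℕ} (hD : D.card = c)
    (hE : E.card = c) (n : ℕ) (A B : Finset ℤ) (hn : A.card = n) (h₁ : A.card ≤ B.card + c)
    (h₂ : B.card ≤ A.card + c) (h₃ : c ≤ A.card + B.card) :
    (2 * ((sumPairs A B D).card + (sumPairs A B E).card) : ℤ) ≤
      2 * (A.card * B.card + B.card * c + c * A.card) - A.card ^ 2 - B.card ^ 2 - c ^ 2 := by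
  have hc : 0 < c := by
    rcases Nat.eq_zero_or_pos c with h | h
    · rw [h, card_eq_zero] at hD hE
      exact absurd (hD.trans hE.symm) hDE
    · exact h
  have hMD : ((sumPairs A B D).card : ℤ) ≤ A.card * B.card := mod_cast card_sumPairs_le A B D
  have hME : ((sumPairs A B E).card : ℤ) ≤ A.card * B.card := mod_cast card_sumPairs_le A B E
  induction n generalizing A B with
  | zero =>
    rw [hn] at h₁ h₂ h₃ hMD hME ⊢
    have : B.card = c := by omega
    rw [this] at hMD hME ⊢
    push_cast at *
    nlinarith
  | succ n ih =>
    have hA : A.Nonempty := card_pos.1 (by omega)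
    rcases B.eq_empty_or_nonempty with hB | hB
    · have hb : B.card = 0 := by simp [hB]
      have : A.card = c := by omega
      rw [hb, this] at hMD hME ⊢
      push_cast at *
      nlinarith
    -- A removal lowers `a + b` by 2, so for nonempty sets it stops at `a + b = c`, where the bound
    -- is the trivial `4ab`, or at `a + b = c + 1`, where it is `4ab - 1` and some pair must be
    -- missing.
    rcases lt_trichotomy (A.card + B.card) (c + 1) with h | h | h
    · have : (c : ℤ) = A.card + B.card := by omega
      rw [this]
      nlinarith
    · have hlt : (sumPairs A B D).card < A.card * B.card ∨
          (sumPairs A B E).card < A.card * B.card := by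
        -- If no pair is missing, `A + B` lies in both `D` and `E`; by Cauchy–Davenport it has at
        -- least `c` elements, so it equals both.
        by_contra! hcon
        have key : ∀ F : Finset ℤ, F.card = c → A.card * B.card ≤ (sumPairs A B F).card →
            A.image₂ (· + ·) B = F := by
          intro F hF hle
          have hall : sumPairs A B F = A ×ˢ B :=
            eq_of_subset_of_card_le (filter_subset _ _) (by rwa [card_product])
          refine eq_of_subset_of_card_le ?_ ?_
          · intro s hs
            obtain ⟨a, ha, b, hb, rfl⟩ := mem_image₂.1 hs
            have : (a, b) ∈ sumPairs A B F := by rw [hall]; exact mem_product.2 ⟨ha, hb⟩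
            exact (mem_sumPairs.1 this).2.2
          · have := cauchy_davenport_add_of_linearOrder_isCancelAdd hA hB
            rw [hF]
            calc c = A.card + B.card - 1 := by omega
              _ ≤ _ := this
        exact hDE ((key D hD hcon.1).symm.trans (key E hE hcon.2))
      have hc' : (c : ℤ) = A.card + B.card - 1 := by omega
      have : ((sumPairs A B D).card + (sumPairs A B E).card : ℤ) ≤ 2 * (A.card * B.card) - 1 := by
        zify at hlt
        omega
      rw [hc']
      nlinarith
    · have hA' := card_erase_of_mem (A.min'_mem hA)
      have hB' := card_erase_of_mem (B.max'_mem hB)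
      have hAp := hA.card_pos
      have hBp := hB.card_pos
      have := ih (A.erase (A.min' hA)) (B.erase (B.max' hB)) (by omega) (by omega) (by omega)
        (by omega) (mod_cast card_sumPairs_le _ _ _) (mod_cast card_sumPairs_le _ _ _)
      have h₄ := card_sumPairs_le_erase_add D hA hB
      have h₅ := card_sumPairs_le_erase_add E hA hB
      rw [hD] at h₄
      rw [hE] at h₅
      have e₁ : ((A.erase (A.min' hA)).card : ℤ) = A.card - 1 := by omega
      have e₂ : ((B.erase (B.max' hB)).card : ℤ) = B.card - 1 := by omega
      rw [e₁, e₂] at this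
      zify at h₄ h₅
      nlinarith

theorem six_mul_card_sumPairs_add_le {D E : Finset ℤ} (hDE : D ≠ E) (hE : E.card = D.card)
    (A B : Finset ℤ) :
    6 * ((sumPairs A B D).card + (sumPairs A B E).card) ≤
      (A.card + B.card + D.card) ^ 2 := by
  have a₁ := card_sumPairs_le A B D
  have a₂ := card_sumPairs_le A B E
  have b₁ := card_sumPairs_le_left A B D
  have b₂ := card_sumPairs_le_left A B E
  have c₁ := card_sumPairs_le_right A B D
  have c₂ := card_sumPairs_le_right A B E
  have main := two_mul_card_sumPairs_add_le hDE rfl hE _ A B rfl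
  rw [hE] at b₂ c₂
  generalize A.card = a at *
  generalize B.card = b at *
  generalize D.card = c at *
  zify at *
  -- If one of `a`, `b`, `c` exceeds the sum of the other two, the product of those two already
  -- bounds each count well enough.
  by_cases h₁ : (a : ℤ) ≤ b + c
  · by_cases h₂ : (b : ℤ) ≤ a + c
    · by_cases h₃ : (c : ℤ) ≤ a + b
      · nlinarith [main h₁ h₂ h₃, sq_nonneg ((a : ℤ) - b), sq_nonneg ((b : ℤ) - c),
          sq_nonneg ((a : ℤ) - c)]
      · nlinarith [sq_nonneg ((a : ℤ) - b)]
    · nlinarith [sq_nonneg ((a : ℤ) - c)]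
  · nlinarith [sq_nonneg ((b : ℤ) - c)]

/-! ### Incidences of edges and triangles; boundaries -/

theorem mem_cells_iff (e : Edge) (c : Triangle) : c ∈ (Tile.mk e).cells ↔ e ∈ c.sides := by
  obtain ⟨⟨x, y⟩, _ | _ | _⟩ := e <;> obtain ⟨⟨u, v⟩⟩ | ⟨⟨u, v⟩⟩ := c <;>
    simp [Tile.cells, Triangle.sides, Prod.ext_iff] <;> omega

theorem card_cells (t : Tile) : t.cells.card = 2 := by
  obtain ⟨⟨⟨x, y⟩, _ | _ | _⟩⟩ := t <;> simp [Tile.cells]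

theorem card_triangle_sides (c : Triangle) : c.sides.card = 3 := by
  obtain ⟨⟨x, y⟩⟩ | ⟨⟨x, y⟩⟩ := c <;> simp [Triangle.sides]

/-- Each edge is a side of two triangles only. -/
theorem eq_or_eq_or_eq_of_mem_sides {e : Edge} {a b c : Triangle} (ha : e ∈ a.sides)
    (hb : e ∈ b.sides) (hc : e ∈ c.sides) : a = b ∨ b = c ∨ a = c := by
  by_contra! h
  have hsub : ({a, b, c} : Finset Triangle) ⊆ (Tile.mk e).cells := by
    simp [insert_subset_iff, mem_cells_iff, ha, hb, hc]
  have := card_le_card hsub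
  rw [card_cells, card_eq_three.2 ⟨a, b, c, h.1, h.2.2, h.2.1, rfl⟩] at this
  omega

/-- The boundary of a finite set of triangles. -/
def boundary (S : Finset Triangle) : Finset Edge :=
  (S.biUnion Triangle.sides).filter fun e => ∃ c ∈ (Tile.mk e).cells, c ∉ S

theorem mem_boundary {S : Finset Triangle} {e : Edge} :
    e ∈ boundary S ↔ (∃ c ∈ S, e ∈ c.sides) ∧ ∃ c, e ∈ c.sides ∧ c ∉ S := by
  simp [boundary, mem_cells_iff]

/-! ### Strips and the isoperimetric inequality -/

/-- In a family of strips, each strip that meets `S` contains two boundary edges across it. Each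
triangle is given its strip, its position in the strip, and the edges and triangles before and
after it; `estrip` and `epos` locate the crossing edges. -/
theorem two_mul_card_image_strip_le (S : Finset Triangle) (d : Dir) (strip pos : Triangle → ℤ)
    (prevE nextE : Triangle → Edge) (prev next : Triangle → Triangle) (estrip epos : Edge → ℤ)
    (hprev : ∀ t, prevE t ∈ t.sides ∧ prevE t ∈ (prev t).sides ∧ (prevE t).dir ≠ d ∧
      strip (prev t) = strip t ∧ pos (prev t) < pos t ∧ estrip (prevE t) = strip t ∧
      epos (prevE t) = pos t)
    (hnext : ∀ t, nextE t ∈ t.sides ∧ nextE t ∈ (next t).sides ∧ (nextE t).dir ≠ d ∧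
      strip (next t) = strip t ∧ pos t < pos (next t) ∧ estrip (nextE t) = strip t ∧
      epos (nextE t) = pos t + 1) :
    2 * (S.image strip).card ≤ ((boundary S).filter fun e => e.dir ≠ d).card := by
  have key : ∀ s ∈ S.image strip, ∃ e ∈ boundary S, ∃ f ∈ boundary S, e ≠ f ∧ e.dir ≠ d ∧
      f.dir ≠ d ∧ estrip e = s ∧ estrip f = s := by
    intro s hs
    obtain ⟨t₀, ht₀, rfl⟩ := mem_image.1 hs
    have hne : (S.filter fun t => strip t = strip t₀).Nonempty := ⟨t₀, by simp [ht₀]⟩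
    obtain ⟨a, ha, hmin⟩ := exists_min_image _ pos hne
    obtain ⟨b, hb, hmax⟩ := exists_max_image _ pos hne
    simp only [mem_filter, and_imp] at ha hb hmin hmax
    obtain ⟨p₁, p₂, p₃, p₄, p₅, p₆, p₇⟩ := hprev a
    obtain ⟨n₁, n₂, n₃, n₄, n₅, n₆, n₇⟩ := hnext b
    refine ⟨prevE a, mem_boundary.2 ⟨⟨a, ha.1, p₁⟩, prev a, p₂, fun h => ?_⟩, nextE b,
      mem_boundary.2 ⟨⟨b, hb.1, n₁⟩, next b, n₂, fun h => ?_⟩, fun h => ?_, p₃, n₃,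
      p₆.trans ha.2, n₆.trans hb.2⟩
    · exact (hmin _ h (p₄.trans ha.2)).not_gt p₅
    · exact (hmax _ h (n₄.trans hb.2)).not_gt n₅
    -- If the first and last crossing edges coincided, then `pos a = pos b + 1`, against the
    -- minimality of `pos a`.
    · have := hmin b hb.1 hb.2
      rw [h] at p₇
      omega
  have hmaps : ∀ s ∈ S.image strip,
      2 ≤ (((boundary S).filter fun e => e.dir ≠ d ∧ estrip e ∈ S.image strip).filter
        fun e => estrip e = s).card := by
    intro s hs
    obtain ⟨e, he, f, hf, hef, hed, hfd, hes, hfs⟩ := key s hs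
    rw [← card_pair hef]
    refine card_le_card ?_
    simp only [insert_subset_iff, singleton_subset_iff, mem_filter]
    exact ⟨⟨⟨he, hed, hes ▸ hs⟩, hes⟩, ⟨⟨hf, hfd, hfs ▸ hs⟩, hfs⟩⟩
  refine (mul_card_image_le_card_of_maps_to (fun e he => (mem_filter.1 he).2.2) 2 hmaps).trans
    (card_le_card fun e he => ?_)
  simp only [mem_filter] at he ⊢
  exact ⟨he.1, he.2.1⟩

/-- The strip of a triangle in the family parallel to a given direction. -/
def Triangle.strip : Dir → Triangle → ℤ
  | .d0, .up p => p.2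
  | .d0, .down p => p.2
  | .d60, .up p => p.1
  | .d60, .down p => p.1
  | .d120, .up p => p.1 + p.2
  | .d120, .down p => p.1 + p.2 + 1

theorem two_mul_card_strips_le (S : Finset Triangle) (d : Dir) :
    2 * (S.image (Triangle.strip d)).card ≤
      ((boundary S).filter fun e => e.dir ≠ d).card := by
  cases d
  · refine two_mul_card_image_strip_le S .d0 _
      (fun | .up p => 2 * p.1 | .down p => 2 * p.1 + 1)
      (fun | .up p => ⟨p, .d60⟩ | .down p => ⟨p + (1, 0), .d120⟩)
      (fun | .up p => ⟨p + (1, 0), .d120⟩ | .down p => ⟨p + (1, 0), .d60⟩)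
      (fun | .up p => .down (p - (1, 0)) | .down p => .up p)
      (fun | .up p => .down p | .down p => .up (p + (1, 0)))
      (fun e => e.start.2)
      (fun | ⟨p, .d60⟩ => 2 * p.1 | ⟨p, _⟩ => 2 * p.1 - 1) ?_ ?_ <;>
    · rintro (⟨⟨x, y⟩⟩ | ⟨⟨x, y⟩⟩) <;> simp [Triangle.sides, Triangle.strip, Prod.ext_iff] <;> omega
  · refine two_mul_card_image_strip_le S .d60 _
      (fun | .up p => 2 * p.2 | .down p => 2 * p.2 + 1)
      (fun | .up p => ⟨p, .d0⟩ | .down p => ⟨p + (1, 0), .d120⟩)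
      (fun | .up p => ⟨p + (1, 0), .d120⟩ | .down p => ⟨p + (0, 1), .d0⟩)
      (fun | .up p => .down (p - (0, 1)) | .down p => .up p)
      (fun | .up p => .down p | .down p => .up (p + (0, 1)))
      (fun | ⟨p, .d0⟩ => p.1 | ⟨p, _⟩ => p.1 - 1)
      (fun | ⟨p, .d0⟩ => 2 * p.2 | ⟨p, _⟩ => 2 * p.2 + 1) ?_ ?_ <;>
    · rintro (⟨⟨x, y⟩⟩ | ⟨⟨x, y⟩⟩) <;> simp [Triangle.sides, Triangle.strip, Prod.ext_iff]; omega
  · refine two_mul_card_image_strip_le S .d120 _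
      (fun | .up p => 2 * p.1 | .down p => 2 * p.1 + 1)
      (fun | .up p => ⟨p, .d60⟩ | .down p => ⟨p + (0, 1), .d0⟩)
      (fun | .up p => ⟨p, .d0⟩ | .down p => ⟨p + (1, 0), .d60⟩)
      (fun | .up p => .down (p - (1, 0)) | .down p => .up (p + (0, 1)))
      (fun | .up p => .down (p - (0, 1)) | .down p => .up (p + (1, 0)))
      (fun e => e.start.1 + e.start.2)
      (fun | ⟨p, .d60⟩ => 2 * p.1 | ⟨p, _⟩ => 2 * p.1 + 1) ?_ ?_ <;>
    · rintro (⟨⟨x, y⟩⟩ | ⟨⟨x, y⟩⟩) <;> simp [Triangle.sides, Triangle.strip, Prod.ext_iff] <;> omega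

/-- Summing over the three directions counts each boundary edge twice, once for each direction not
its own. -/
theorem card_strips_le (S : Finset Triangle) :
    (S.image (Triangle.strip .d60)).card + (S.image (Triangle.strip .d0)).card +
      (S.image (Triangle.strip .d120)).card ≤ (boundary S).card := by
  have h : ∀ d : Dir, ((boundary S).filter fun e => e.dir ≠ d).card +
      ((boundary S).filter fun e => e.dir = d).card = (boundary S).card := fun d => by
    rw [add_comm]; exact card_filter_add_card_filter_not _
  have hsum : ((boundary S).filter fun e => e.dir = .d0).card +
      ((boundary S).filter fun e => e.dir = .d60).card +
      ((boundary S).filter fun e => e.dir = .d120).card = (boundary S).card := by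
    rw [← card_filter_add_card_filter_not (s := boundary S) (fun e => e.dir = .d0), add_assoc]
    congr 1
    rw [← card_filter_add_card_filter_not (s := (boundary S).filter fun e => ¬ e.dir = .d0)
      (fun e => e.dir = .d60), filter_filter, filter_filter]
    congr 2 <;> ext e <;> cases h : e.dir <;> simp [h]
  have := two_mul_card_strips_le S .d0
  have := two_mul_card_strips_le S .d60
  have := two_mul_card_strips_le S .d120
  have := h .d0
  have := h .d60
  have := h .d120
  omega

/-- The two terms count up and down triangles; the shift by 1 comes from `down p` lying in the 120°
strip `p.1 + p.2 + 1`. -/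
theorem card_le_card_sumPairs_add (S : Finset Triangle) :
    S.card ≤
      (sumPairs (S.image (Triangle.strip .d60)) (S.image (Triangle.strip .d0))
        (S.image (Triangle.strip .d120))).card +
      (sumPairs (S.image (Triangle.strip .d60)) (S.image (Triangle.strip .d0))
        ((S.image (Triangle.strip .d120)).image (· - 1))).card := by
  rw [← card_disjSum]
  refine card_le_card_of_injOn (fun | .up p => .inl p | .down p => .inr p) ?_ ?_
  · rintro (⟨⟨x, y⟩⟩ | ⟨⟨x, y⟩⟩) h
    · simp only [mem_coe, inl_mem_disjSum, mem_sumPairs, mem_image]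
      exact ⟨⟨_, h, rfl⟩, ⟨_, h, rfl⟩, ⟨_, h, rfl⟩⟩
    · simp only [mem_coe, inr_mem_disjSum, mem_sumPairs, mem_image]
      exact ⟨⟨_, h, rfl⟩, ⟨_, h, rfl⟩, ⟨_, ⟨_, h, rfl⟩, by simp [Triangle.strip]⟩⟩
  · rintro (p | p) - (q | q) - h <;> simp_all

theorem image_sub_one_ne {D : Finset ℤ} (hD : D.Nonempty) : D ≠ D.image (· - 1) := by
  intro h
  have : D.min' hD - 1 ∈ D := by
    exact h.symm.subset (mem_image_of_mem (· - 1) (D.min'_mem hD))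
  have := D.min'_le _ this
  omega

/-- The isoperimetric inequality for finite sets of lattice triangles. -/
theorem six_mul_card_le_card_boundary_sq (S : Finset Triangle) :
    6 * S.card ≤ (boundary S).card ^ 2 := by
  rcases S.eq_empty_or_nonempty with rfl | hS
  · simp
  have hE : ((S.image (Triangle.strip .d120)).image (· - 1)).card =
      (S.image (Triangle.strip .d120)).card :=
    card_image_of_injective _ (sub_left_injective)
  calc 6 * S.card ≤ _ := Nat.mul_le_mul_left 6 (card_le_card_sumPairs_add S)
    _ ≤ _ := six_mul_card_sumPairs_add_le (image_sub_one_ne (hS.image _)) hE _ _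
    _ ≤ _ := Nat.pow_le_pow_left (card_strips_le S) 2

/-! ### Sides of tiles and edge counts in a packing -/

theorem mem_tile_sides {t : Tile} {e : Edge} :
    e ∈ t.sides ↔ e ≠ t.diag ∧ ∃ c ∈ t.cells, e ∈ c.sides := by
  simp [Tile.sides]

theorem card_tile_sides (t : Tile) : t.sides.card = 4 := by
  obtain ⟨⟨⟨x, y⟩, _ | _ | _⟩⟩ := t <;>
    simp [Tile.sides, Tile.cells, Triangle.sides, card_insert_eq_ite] <;> omega

/-- The height of an edge above a lattice line parallel to it. -/
def Edge.height : Edge → ℤ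
  | ⟨p, .d0⟩ => p.2
  | ⟨p, .d60⟩ => p.1
  | ⟨p, .d120⟩ => p.1 + p.2

/-- Opposite sides of a tile lie on consecutive parallel lattice lines. Parity then rules out three
pairwise opposite edges. -/
theorem odd_height_add_height {t : Tile} {e f : Edge} (he : e ∈ t.sides) (hf : f ∈ t.sides)
    (hd : e.dir = f.dir) (hef : e ≠ f) : Odd (e.height + f.height) := by
  rw [Int.odd_iff]
  obtain ⟨⟨⟨x, y⟩, _ | _ | _⟩⟩ := t <;> obtain ⟨⟨z, w⟩, _ | _ | _⟩ := e <;>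
    obtain ⟨⟨u, v⟩, _ | _ | _⟩ := f <;>
    simp [Tile.sides, Tile.cells, Triangle.sides, Prod.ext_iff, Edge.height] at * <;> omega

/-- The sides of a tile in a given direction are at most two. -/
theorem eq_of_parallel_sides {t : Tile} {e f g : Edge} (he : e ∈ t.sides) (hf : f ∈ t.sides)
    (hg : g ∈ t.sides) (hef : e ≠ f) (heg : e ≠ g) (hdf : e.dir = f.dir) (hdg : e.dir = g.dir) :
    f = g := by
  by_contra hfg
  have h₁ := Int.odd_iff.1 (odd_height_add_height he hf hdf hef)
  have h₂ := Int.odd_iff.1 (odd_height_add_height he hg hdg heg)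
  have h₃ := Int.odd_iff.1 (odd_height_add_height hf hg (hdf.symm.trans hdg) hfg)
  omega

/-- The tiles of `T` have pairwise disjoint interiors. -/
def Packing (T : Finset Tile) : Prop := ∀ A ∈ T, ∀ B ∈ T, A ≠ B → Disjoint A.cells B.cells

theorem Packing.eq_of_mem_cells {T : Finset Tile} (hT : Packing T) {A B : Tile} (hA : A ∈ T)
    (hB : B ∈ T) {c : Triangle} (ha : c ∈ A.cells) (hb : c ∈ B.cells) : A = B := by
  by_contra h
  exact disjoint_left.1 (hT A hA B hB h) ha hb

theorem Packing.eq_or_eq_or_eq {T : Finset Tile} (hT : Packing T) {A B C : Tile} (hA : A ∈ T)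
    (hB : B ∈ T) (hC : C ∈ T) {e : Edge} (ha : e ∈ A.sides) (hb : e ∈ B.sides)
    (hc : e ∈ C.sides) : A = B ∨ B = C ∨ A = C := by
  obtain ⟨-, a, haA, hea⟩ := mem_tile_sides.1 ha
  obtain ⟨-, b, hbB, heb⟩ := mem_tile_sides.1 hb
  obtain ⟨-, c, hcC, hec⟩ := mem_tile_sides.1 hc
  rcases eq_or_eq_or_eq_of_mem_sides hea heb hec with rfl | rfl | rfl
  · exact .inl (hT.eq_of_mem_cells hA hB haA hbB)
  · exact .inr (.inl (hT.eq_of_mem_cells hB hC hbB hcC))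
  · exact .inr (.inr (hT.eq_of_mem_cells hA hC haA hcC))

/-- The triangles covered by the tiles of `T`. -/
def covered (T : Finset Tile) : Finset Triangle := T.biUnion Tile.cells

theorem Packing.card_covered {T : Finset Tile} (hT : Packing T) :
    (covered T).card = 2 * T.card := by
  rw [covered, card_biUnion fun A hA B hB => hT A hA B hB, sum_congr rfl fun t _ => card_cells t,
    sum_const, smul_eq_mul, mul_comm]

/-- The edges that are sides of two tiles of `T`. -/
def sharedEdges (T : Finset Tile) : Finset Edge :=
  (T.biUnion Tile.sides).filter fun e => ∃ A ∈ T, ∃ B ∈ T, A ≠ B ∧ e ∈ A.sides ∧ e ∈ B.sides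

theorem mem_sharedEdges {T : Finset Tile} {e : Edge} :
    e ∈ sharedEdges T ↔ ∃ A ∈ T, ∃ B ∈ T, A ≠ B ∧ e ∈ A.sides ∧ e ∈ B.sides := by
  simp only [sharedEdges, mem_filter, mem_biUnion, and_iff_right_iff_imp]
  rintro ⟨A, hA, -, -, -, h, -⟩
  exact ⟨A, hA, h⟩

theorem Packing.disjoint_boundary_sharedEdges {T : Finset Tile} (hT : Packing T) :
    Disjoint (boundary (covered T)) (sharedEdges T) := by
  refine disjoint_left.2 fun e he hs => ?_
  obtain ⟨-, c, hec, hc⟩ := mem_boundary.1 he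
  obtain ⟨A, hA, B, hB, hAB, ha, hb⟩ := mem_sharedEdges.1 hs
  obtain ⟨-, a, haA, hea⟩ := mem_tile_sides.1 ha
  obtain ⟨-, b, hbB, heb⟩ := mem_tile_sides.1 hb
  rcases eq_or_eq_or_eq_of_mem_sides hea heb hec with rfl | rfl | rfl
  · exact hAB (hT.eq_of_mem_cells hA hB haA hbB)
  · exact hc (mem_biUnion.2 ⟨B, hB, hbB⟩)
  · exact hc (mem_biUnion.2 ⟨A, hA, haA⟩)

theorem exists_side_of_mem_boundary {T : Finset Tile} {e : Edge}
    (he : e ∈ boundary (covered T)) : ∃ t ∈ T, e ∈ t.sides := by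
  obtain ⟨⟨c, hc, hec⟩, d, hed, hd⟩ := mem_boundary.1 he
  obtain ⟨t, ht, hct⟩ := mem_biUnion.1 hc
  refine ⟨t, ht, mem_tile_sides.2 ⟨?_, c, hct, hec⟩⟩
  rintro rfl
  exact hd (mem_biUnion.2 ⟨t, ht, (mem_cells_iff t.diag d).2 hed⟩)

/-- Double counting of incidences: a tile has four sides, a boundary edge lies on at least one tile,
a shared edge on at least two. -/
theorem Packing.card_boundary_add_le {T : Finset Tile} (hT : Packing T) :
    (boundary (covered T)).card + 2 * (sharedEdges T).card ≤ 4 * T.card := by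
  have hcount := sum_card_bipartiteAbove_eq_sum_card_bipartiteBelow
    (s := T) (t := boundary (covered T) ∪ sharedEdges T) (fun t e => e ∈ t.sides)
  rw [sum_union hT.disjoint_boundary_sharedEdges] at hcount
  have hle : ∑ t ∈ T, ((boundary (covered T) ∪ sharedEdges T).bipartiteAbove
      (fun t e => e ∈ t.sides) t).card ≤ 4 * T.card := by
    rw [mul_comm, ← smul_eq_mul]
    refine sum_le_card_nsmul _ _ _ fun t _ => ?_
    rw [← card_tile_sides t]
    exact card_le_card fun e he => (mem_bipartiteAbove _).1 he |>.2
  have h₁ : (boundary (covered T)).card • 1 ≤ ∑ e ∈ boundary (covered T),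
      (T.bipartiteBelow (fun t e => e ∈ t.sides) e).card := by
    refine card_nsmul_le_sum _ _ _ fun e he => ?_
    obtain ⟨t, ht, het⟩ := exists_side_of_mem_boundary he
    exact card_pos.2 ⟨t, (mem_bipartiteBelow _).2 ⟨ht, het⟩⟩
  have h₂ : (sharedEdges T).card • 2 ≤ ∑ e ∈ sharedEdges T,
      (T.bipartiteBelow (fun t e => e ∈ t.sides) e).card := by
    refine card_nsmul_le_sum _ _ _ fun e he => ?_
    obtain ⟨A, hA, B, hB, hAB, ha, hb⟩ := mem_sharedEdges.1 he
    rw [← card_pair hAB]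
    refine card_le_card ?_
    simp [insert_subset_iff, mem_bipartiteBelow, hA, hB, ha, hb]
  simp only [smul_eq_mul] at h₁ h₂
  omega

/-- A connected graph on `n` vertices has at least `n - 1` edges. Choosing a common side for each
adjacency is injective, because a side determines the two tiles on it. -/
theorem Packing.card_le_card_sharedEdges_add_one {T : Finset Tile} (hT : Packing T)
    (hc : (adjacency.induce (T : Set Tile)).Connected) :
    T.card ≤ (sharedEdges T).card + 1 := by
  have hex : ∀ x : (adjacency.induce (T : Set Tile)).edgeSet, ∃ p : sharedEdges T,
      ∀ t : (T : Set Tile), t ∈ x.1 ↔ p.1 ∈ t.1.sides := by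
    rintro ⟨x, hx⟩
    induction x with
    | _ A B =>
      obtain ⟨hAB, p, hp⟩ : adjacency.Adj A.1 B.1 := hx
      rw [mem_inter] at hp
      refine ⟨⟨p, mem_sharedEdges.2 ⟨A, A.2, B, B.2, hAB, hp⟩⟩, fun t => ?_⟩
      rw [Sym2.mem_iff]
      constructor
      · rintro (rfl | rfl)
        exacts [hp.1, hp.2]
      · intro ht
        rcases hT.eq_or_eq_or_eq A.2 B.2 t.2 hp.1 hp.2 ht with h | h | h
        · exact absurd h hAB
        · exact .inr (Subtype.ext h.symm)
        · exact .inl (Subtype.ext h.symm)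
  choose f hf using hex
  have hinj : Function.Injective f := fun x y hxy =>
    Subtype.ext (Sym2.ext fun t => by rw [hf x t, hf y t, hxy])
  have h₁ := hc.card_vert_le_card_edgeSet_add_one
  have h₂ := Nat.card_le_card_of_injective f hinj
  simp only [Nat.card_eq_fintype_card, Fintype.card_coe, coe_sort_coe] at h₁ h₂
  omega

/-! ### Parity of the number of shared edges -/

theorem even_card_of_existsUnique {α : Type*} [DecidableEq α] {s : Finset α} {R : α → α → Prop}
    (hsymm : ∀ a b, R a b → R b a) (hirr : ∀ a, ¬ R a a)
    (h : ∀ a ∈ s, ∃ b ∈ s, R a b) (huniq : ∀ a ∈ s, ∀ b ∈ s, ∀ c ∈ s, R a b → R a c → b = c) :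
    Even s.card := by
  choose g hgs hg using h
  have : ∑ _a ∈ s, (1 : ZMod 2) = 0 := by
    refine sum_involution g (fun _ _ => by decide) (fun a ha _ hga => hirr a ?_) hgs fun a ha => ?_
    · simpa only [hga] using hg a ha
    · exact huniq _ (hgs a ha) _ (hgs _ _) _ ha (hg _ _) (hsymm _ _ (hg a ha))
  rw [sum_const, nsmul_one] at this
  exact (ZMod.natCast_eq_zero_iff_even).1 this

/-- Two edges are opposite in `T` if they are opposite sides of a tile of `T`. -/
def Opposite (T : Finset Tile) (p q : Edge) : Prop :=
  p ≠ q ∧ p.dir = q.dir ∧ ∃ A ∈ T, p ∈ A.sides ∧ q ∈ A.sides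

theorem exists_opposite {T : Finset Tile} (hT : IsTredokuTiling T) {p : Edge}
    (hp : p ∈ sharedEdges T) : ∃ q ∈ sharedEdges T, Opposite T p q := by
  obtain ⟨A, hA, B, hB, hAB, ha, hb⟩ := mem_sharedEdges.1 hp
  obtain ⟨C, hC, hCA, hCB, q, hqC, hd, hq⟩ :=
    hT.third_tile A hA B hB hAB p (mem_inter.2 ⟨ha, hb⟩)
  have hpq : p ≠ q := by
    rintro rfl
    rcases Packing.eq_or_eq_or_eq hT.not_overlap hA hB hC ha hb hqC with h | h | h
    exacts [hAB h, hCB h.symm, hCA h.symm]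
  refine ⟨q, mem_sharedEdges.2 ?_, hpq, hd.symm, ?_⟩
  · rcases hq with hq | hq
    exacts [⟨C, hC, A, hA, hCA, hqC, hq⟩, ⟨C, hC, B, hB, hCB, hqC, hq⟩]
  · rcases hq with hq | hq
    exacts [⟨A, hA, ha, hq⟩, ⟨B, hB, hb, hq⟩]

theorem exists_ne_of_mem_sharedEdges {T : Finset Tile} {e : Edge} (he : e ∈ sharedEdges T)
    (A : Tile) : ∃ C ∈ T, C ≠ A ∧ e ∈ C.sides := by
  obtain ⟨B, hB, C, hC, hBC, hb, hc⟩ := mem_sharedEdges.1 he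
  by_cases h : B = A
  · exact ⟨C, hC, fun h' => hBC (h.trans h'.symm), hc⟩
  · exact ⟨B, hB, h, hb⟩

/-- Two different shared edges opposite to `p` would extend the tiles on either side of `p` to a run
of four, against P5. -/
theorem opposite_unique {T : Finset Tile} (hT : IsTredokuTiling T) {p q r : Edge}
    (hq : q ∈ sharedEdges T) (hr : r ∈ sharedEdges T) (hpq : Opposite T p q)
    (hpr : Opposite T p r) : q = r := by
  obtain ⟨hne, hd, A, hA, hpA, hqA⟩ := hpq
  obtain ⟨hne', hd', B, hB, hpB, hrB⟩ := hpr
  by_contra hqr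
  obtain ⟨C, hC, hCA, hqC⟩ := exists_ne_of_mem_sharedEdges hq A
  obtain ⟨D, hD, hDB, hrD⟩ := exists_ne_of_mem_sharedEdges hr B
  have hAB : A ≠ B := by
    rintro rfl
    exact hqr (eq_of_parallel_sides hpA hqA hrB hne hne' hd hd')
  have hCB : C ≠ B := by
    rintro rfl
    exact hqr (eq_of_parallel_sides hpB hqC hrB hne hne' hd hd')
  have hDA : D ≠ A := by
    rintro rfl
    exact hqr (eq_of_parallel_sides hpA hqA hrD hne hne' hd hd')
  -- If `C = D`, the edges `p`, `q`, `r` are pairwise opposite sides of tiles: three odd height sums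
  -- with an even total.
  have hCD : C ≠ D := by
    rintro rfl
    have h₁ := Int.odd_iff.1 (odd_height_add_height hpA hqA hd hne)
    have h₂ := Int.odd_iff.1 (odd_height_add_height hpB hrB hd' hne')
    have h₃ := Int.odd_iff.1 (odd_height_add_height hqC hrD (hd.symm.trans hd') hqr)
    omega
  have hrun : IsRun T p.dir [C, A, B, D] := by
    refine ⟨by simp [hC, hA, hB, hD], by simp [hCA, hCB, hCD, hAB, hDA.symm, hDB.symm], ?_⟩
    simp only [List.isChain_cons_cons, List.isChain_singleton, and_true]
    exact ⟨⟨q, hd.symm, hqC, hqA⟩, ⟨p, rfl, hpA, hpB⟩, ⟨r, hd'.symm, hrB, hrD⟩⟩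
  have := hT.run_length_le _ _ hrun
  simp at this

/-- The shared edges of a tredoku tiling come in pairs, one pair in each run of three tiles. -/
theorem even_card_sharedEdges {T : Finset Tile} (hT : IsTredokuTiling T) :
    Even (sharedEdges T).card :=
  even_card_of_existsUnique (R := Opposite T)
    (fun _ _ ⟨h, hd, A, hA, hp, hq⟩ => ⟨h.symm, hd.symm, A, hA, hq, hp⟩) (fun _ h => h.1 rfl)
    (fun _ hp => exists_opposite hT hp) fun _ _ _ hq _ hr h h' => opposite_unique hT hq hr h h'

/-! ### Filling triangular holes -/

theorem mem_uncovered_iff {T : Finset Tile} {c : Triangle} :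
    c ∈ uncovered T ↔ c ∉ covered T := by
  simp [uncovered, covered]

/-- A triangle that is a hole is uncovered and all its neighbours are covered. -/
theorem hole_singleton {T : Finset Tile} {c : Triangle} (h : {c} ∈ holes T) :
    c ∉ covered T ∧ ∀ d, triangleAdjacency.Adj c d → d ∈ covered T := by
  obtain ⟨-, K, hK⟩ := h
  obtain ⟨c', hc'K, hc'⟩ : c ∈ Subtype.val '' K.supp := hK ▸ Set.mem_singleton c
  subst hc'
  refine ⟨mem_uncovered_iff.1 c'.2, fun d hd => ?_⟩
  by_contra hdc
  have hadj : (triangleAdjacency.induce (uncovered T)).Adj c' ⟨d, mem_uncovered_iff.2 hdc⟩ := hd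
  have hmem : d ∈ ({c'.1} : Set Triangle) :=
    hK ▸ ⟨_, (SimpleGraph.ConnectedComponent.mem_supp_congr_adj K hadj).1 hc'K, rfl⟩
  exact hd.ne (Set.mem_singleton_iff.1 hmem).symm

/-- Every side of a triangle of `H` separates it from `U`, so these sides are distinct boundary
edges of `U` that disappear on filling, and no new ones arise. -/
theorem card_boundary_union_add_le (U H : Finset Triangle)
    (hH : ∀ c ∈ H, c ∉ U ∧ ∀ d, triangleAdjacency.Adj c d → d ∈ U) :
    (boundary (U ∪ H)).card + 3 * H.card ≤ (boundary U).card := by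
  have hadj : ∀ {c d : Triangle} {e : Edge}, e ∈ c.sides → e ∈ d.sides → c ∈ H → c ≠ d →
      d ∈ U := fun hc hd hcH hcd => (hH _ hcH).2 _ ⟨hcd, _, mem_inter.2 ⟨hc, hd⟩⟩
  have hdisj : (H : Set Triangle).PairwiseDisjoint Triangle.sides := by
    intro c hc d hd hcd
    refine disjoint_left.2 fun e hec hed => ?_
    exact (hH d hd).1 (hadj hec hed hc hcd)
  have hcard : (H.biUnion Triangle.sides).card = 3 * H.card := by
    rw [card_biUnion hdisj, sum_congr rfl fun c _ => card_triangle_sides c, sum_const,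
      smul_eq_mul, mul_comm]
  rw [← hcard, ← card_union_of_disjoint]
  · refine card_le_card (union_subset (fun e he => ?_) fun e he => ?_)
    · obtain ⟨⟨c, hc, hec⟩, d, hed, hd⟩ := mem_boundary.1 he
      rw [mem_union, not_or] at hd
      refine mem_boundary.2 ⟨⟨c, (mem_union.1 hc).resolve_right fun hcH => ?_, hec⟩, d, hed, hd.1⟩
      refine hd.1 (hadj hec hed hcH ?_)
      rintro rfl
      exact hd.2 hcH
    · obtain ⟨c, hc, hec⟩ := mem_biUnion.1 he
      obtain ⟨d, hd, hcd⟩ := exists_mem_ne (by rw [card_cells]; omega) c (s := (Tile.mk e).cells)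
      rw [mem_cells_iff] at hd
      exact mem_boundary.2 ⟨⟨d, hadj hec hd hc hcd.symm, hd⟩, c, hec, (hH c hc).1⟩
  · refine disjoint_left.2 fun e he heH => ?_
    obtain ⟨-, d, hed, hd⟩ := mem_boundary.1 he
    obtain ⟨c, hc, hec⟩ := mem_biUnion.1 heH
    rw [mem_union, not_or] at hd
    refine hd.1 (hadj hec hed hc ?_)
    rintro rfl
    exact hd.2 hc

theorem exists_holes_finset {T : Finset Tile} {η : ℕ} (hη : (holes T).encard = η)
    (htri : ∀ H ∈ holes T, ∃ c : Triangle, H = {c}) :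
    ∃ F : Finset Triangle, F.card = η ∧ ∀ c ∈ F, {c} ∈ holes T := by
  have himage : (fun c : Triangle => ({c} : Set Triangle)) '' {c | {c} ∈ holes T} = holes T := by
    ext H
    constructor
    · rintro ⟨c, hc, rfl⟩
      exact hc
    · intro hH
      obtain ⟨c, rfl⟩ := htri H hH
      exact ⟨c, hH, rfl⟩
  rw [← himage, Set.InjOn.encard_image Set.singleton_injective.injOn] at hη
  have hfin : {c : Triangle | {c} ∈ holes T}.Finite := Set.finite_of_encard_eq_coe hη
  refine ⟨hfin.toFinset, ?_, fun c hc => hfin.mem_toFinset.1 hc⟩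
  rw [hfin.encard_eq_coe_toFinset_card] at hη
  exact_mod_cast hη

end Tredoku

/-! ### The inequality -/

theorem mainTheorem10 (T : Finset Tredoku.Tile) (hT : Tredoku.IsTredokuTiling T) (τ η : ℕ)
    (hτ : T.card = τ) (hη : (Tredoku.holes T).encard = (η : ℕ∞))
    (htri : ∀ H ∈ Tredoku.holes T, ∃ c : Tredoku.Triangle, H = {c}) :
    2 * ⌊((τ : ℝ) + 1) / 2⌋ ≥
      ⌈(1 / 2 : ℝ) * ((η : ℝ) + √(6 * (2 * (τ : ℝ) + (η : ℝ))))⌉ + (η : ℤ) := by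
  have hP : Tredoku.Packing T := hT.not_overlap
  obtain ⟨F, hFη, hF⟩ := Tredoku.exists_holes_finset hη htri
  have hF' := fun c hc => Tredoku.hole_singleton (hF c hc)
  have hfill := Tredoku.card_boundary_union_add_le (Tredoku.covered T) F hF'
  have hiso := Tredoku.six_mul_card_le_card_boundary_sq (Tredoku.covered T ∪ F)
  rw [Finset.card_union_of_disjoint (Finset.disjoint_right.2 fun c hc => (hF' c hc).1),
    hP.card_covered, hFη, hτ] at hiso
  have hper := hP.card_boundary_add_le
  have hconn := hP.card_le_card_sharedEdges_add_one hT.connected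
  obtain ⟨r, hr⟩ := Tredoku.even_card_sharedEdges hT
  rw [hFη] at hfill
  rw [hτ] at hper hconn
  -- Evenness enters here: `r` is an integer, so `τ ≤ 2r + 1` survives the floor.
  have hfloor : (τ : ℤ) - r ≤ ⌊((τ : ℝ) + 1) / 2⌋ := by
    rw [Int.le_floor]
    have : (τ : ℝ) ≤ 2 * r + 1 := by exact_mod_cast (by omega : τ ≤ 2 * r + 1)
    push_cast
    linarith
  have hiso' : 6 * (2 * (τ : ℝ) + η) ≤
      ((Tredoku.boundary (Tredoku.covered T ∪ F)).card : ℝ) ^ 2 := by exact_mod_cast hiso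
  have hsqrt : √(6 * (2 * (τ : ℝ) + η)) ≤ 4 * τ - 4 * r - 3 * η := by
    refine (Real.sqrt_le_sqrt hiso').trans ?_
    rw [Real.sqrt_sq (Nat.cast_nonneg _)]
    have : (((Tredoku.boundary (Tredoku.covered T ∪ F)).card + 3 * η + 4 * r : ℕ) : ℝ) ≤
        (4 * τ : ℕ) := by
      exact_mod_cast (by omega)
    push_cast at this
    linarith
  have hceil : ⌈(1 / 2 : ℝ) * ((η : ℝ) + √(6 * (2 * (τ : ℝ) + (η : ℝ))))⌉ ≤
      2 * ((τ : ℤ) - r) - η := by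
    rw [Int.ceil_le]
    push_cast
    linarith
  linarith
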